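/- Let $\widehat{\mathbb C}=\mathbb C\cup\{\infty\}$ be the Riemann sphere, $\widehat{\mathbb C}^*=\widehat{\mathbb C}\setminus\{0\}$, and $$\Omega=\{(z,w)\in\widehat{\mathbb C}^2 : z\cdot w\neq 1\},$$ where $\infty\cdot 0=0\cdot\infty=1$ and $\infty\cdot z=z\cdot\infty=\infty$ for $z\in\widehat{\mathbb C}^*$. For $m\in\mathbb N_0$ and $n\in\mathbb Z$ let the Poisson Fourier mode $P_n^{-m}:\Omega\to\mathbb C$ be given by $$P_n^{-m}(z,w)=(-1)^n\binom{m}{|n|}(1-zw)^{-m}\,{}_2F_1(-m,|n|-m;|n|+1;zw)\cdot\begin{cases}w^n & (n\ge 0)\\ z^{|n|} & (n\le 0)\end{cases}$$ for $(z,w)\in\Omega\cap\mathbb C^2$, and by continuous extension at the points of $\Omega$ with a component $\infty$ (the hypergeometric series terminates whenever $|n|\le m$, and $P_n^{-m}=0$ for $|n|>m$). For $|n|\le m$ put $$Y_n^{-m}=\sqrt{2m+1}\,\binom{m}{|n|}^{-1/2}\binom{-m-1}{|n|}^{1/2}P_n^{-m},$$ with principal values of the square roots, and define the complex zonal harmonic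 of degree $m$ by $$Z_m\big((z,w),(u,v)\big)=\sum_{j=-m}^{m}Y_j^{-m}(z,w)\,Y_{-j}^{-m}(u,v),\qquad (z,w),(u,v)\in\Omega.$$ For $(u,v)\in\Omega$ with $u,v\in\mathbb C$ let $T_{u,v}:\Omega\to\Omega$ be the automorphism $$T_{u,v}(z,w)=\Big(\frac{u-z}{1-vz},\frac{v-w}{1-uw}\Big)$$ (both components being understood as Möbius transformations of $\widehat{\mathbb C}$), and for $(u,v)\in\Omega$ with $u,v\in\widehat{\mathbb C}^*$ let $$\widetilde T_{u,v}(z,w)=T_{1/v,1/u}\Big(\frac1w,\frac1z\Big),\qquad (z,w)\in\Omega,$$ where $1/0=\infty$ and $1/\infty=0$. Proposition. Let $m\in\mathbb N_0$ and $(z,w),(u,v)\in\Omega$. Then $$Z_m\big((z,w),(u,v)\big)=(2m+1)\,\big(P_0^{-m}\circ T_{u,v}\big)(z,w)\qquad\text{if }u,v\in\mathbb C,$$ $$Z_m\big((z,w),(u,v)\big)=(2m+1)\,\big(P_0^{-m}\circ \widetilde T_{u,v}\big)(z,w)\qquad\text{if }u,v\in\widehat{\mathbb C}^*.$$ -/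

import Mathlib

open scoped OnePoint Topology

namespace ComplexZonal

/-- The Riemann sphere. -/
abbrev Sphere : Type := OnePoint ℂ

/-- Multiplication on the Riemann sphere, with the convention `∞ · 0 = 0 · ∞ = 1` and
`∞ · z = z · ∞ = ∞` for `z ≠ 0`. -/
noncomputable def sphereMul : Sphere → Sphere → Sphere
  | .some z, .some w => ((z * w : ℂ) : Sphere)
  | .some z, ∞ => if z = 0 then ((1 : ℂ) : Sphere) else ∞
  | ∞, .some w => if w = 0 then ((1 : ℂ) : Sphere) else ∞
  | ∞, ∞ => ∞

/-- The reciprocal `z ↦ 1 / z` on the Riemann sphere, with `1 / 0 = ∞` and `1 / ∞ = 0`. -/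
noncomputable def sphereInv : Sphere → Sphere
  | .some z => if z = 0 then ∞ else ((z⁻¹ : ℂ) : Sphere)
  | ∞ => ((0 : ℂ) : Sphere)

/-- The domain `Ω = {(z, w) | z · w ≠ 1}` in the product of two Riemann spheres. -/
def Omega : Set (Sphere × Sphere) := {p | sphereMul p.1 p.2 ≠ ((1 : ℂ) : Sphere)}

/-- The Möbius transformation `ψ_{u,v}(z) = (u - z) / (1 - v z)` of the Riemann sphere
(it is used for `u v ≠ 1` only). -/
noncomputable def psi (u v : ℂ) : Sphere → Sphere
  | .some z => if 1 - v * z = 0 then ∞ else (((u - z) / (1 - v * z) : ℂ) : Sphere)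
  | ∞ => if v = 0 then ∞ else ((1 / v : ℂ) : Sphere)

lemma mem_Omega_coe (z w : ℂ) : ((z : Sphere), (w : Sphere)) ∈ Omega ↔ z * w ≠ 1 := by
  simp [Omega, sphereMul]

lemma mem_Omega_coe_infty (z : ℂ) : ((z : Sphere), (∞ : Sphere)) ∈ Omega ↔ z ≠ 0 := by
  by_cases h : z = 0 <;> simp [Omega, sphereMul, h]

lemma mem_Omega_infty_coe (w : ℂ) : ((∞ : Sphere), (w : Sphere)) ∈ Omega ↔ w ≠ 0 := by
  by_cases h : w = 0 <;> simp [Omega, sphereMul, h]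

lemma mem_Omega_infty_infty : ((∞ : Sphere), (∞ : Sphere)) ∈ Omega := by
  simp [Omega, sphereMul]

lemma psi_mem_Omega {u v : ℂ} (h : u * v ≠ 1) {p : Sphere × Sphere} (hp : p ∈ Omega) :
    (psi u v p.1, psi v u p.2) ∈ Omega := by
  obtain ⟨z, w⟩ := p
  have huv : 1 - u * v ≠ 0 := fun h' => h (by linear_combination -h')
  have hvu : 1 - v * u ≠ 0 := fun h' => h (by linear_combination -h')
  induction z using OnePoint.rec with
  | infty =>
    induction w using OnePoint.rec with
    | infty =>
      by_cases hv : v = 0 <;> by_cases hu : u = 0 <;>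
        simp [psi, hu, hv, mem_Omega_coe, mem_Omega_coe_infty, mem_Omega_infty_coe,
          mem_Omega_infty_infty]
      intro h1
      apply h
      field_simp at h1
      linear_combination -h1
    | coe w =>
      rw [mem_Omega_infty_coe] at hp
      by_cases hv : v = 0 <;> by_cases hu : 1 - u * w = 0
      · simp [psi, hu, hv, mem_Omega_infty_infty]
      · simp [psi, hu, hv, mem_Omega_infty_coe, hp]
      · simp [psi, hu, hv, mem_Omega_coe_infty]
      · simp only [psi, hu, hv, if_false, mem_Omega_coe]
        intro h1
        rw [div_mul_div_comm, div_eq_one_iff_eq (mul_ne_zero hv hu)] at h1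
        have : w * (1 - u * v) = 0 := by linear_combination -h1
        simp_all
  | coe z =>
    induction w using OnePoint.rec with
    | infty =>
      rw [mem_Omega_coe_infty] at hp
      by_cases hu : u = 0 <;> by_cases hv : 1 - v * z = 0
      · simp [psi, hu, hv, mem_Omega_infty_infty]
      · simp [psi, hu, hv, mem_Omega_coe_infty, hp]
      · simp [psi, hu, hv, mem_Omega_infty_coe]
      · simp only [psi, hu, hv, if_false, mem_Omega_coe]
        intro h1
        rw [div_mul_div_comm, div_eq_one_iff_eq (mul_ne_zero hv hu)] at h1
        have : z * (1 - u * v) = 0 := by linear_combination -h1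
        simp_all
    | coe w =>
      rw [mem_Omega_coe] at hp
      have hzw : 1 - z * w ≠ 0 := fun h' => hp (by linear_combination -h')
      by_cases hv : 1 - v * z = 0 <;> by_cases hu : 1 - u * w = 0
      · simp [psi, hu, hv, mem_Omega_infty_infty]
      · simp only [psi, hu, hv, if_false, if_true, mem_Omega_infty_coe]
        intro h1
        rw [div_eq_zero_iff, or_iff_left hu] at h1
        exact hp (by linear_combination -hv - z * h1)
      · simp only [psi, hu, hv, if_false, if_true, mem_Omega_coe_infty]
        intro h1
        rw [div_eq_zero_iff, or_iff_left hv] at h1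
        exact hp (by linear_combination -hu - w * h1)
      · simp only [psi, hu, hv, if_false, mem_Omega_coe]
        intro h1
        rw [div_mul_div_comm, div_eq_one_iff_eq (mul_ne_zero hv hu)] at h1
        exact mul_ne_zero huv hzw (by linear_combination -h1)

/-- The flip map `(z, w) ↦ (1 / w, 1 / z)` of `Ω`. -/
noncomputable def flipMap (p : Omega) : Omega :=
  ⟨(sphereInv p.1.2, sphereInv p.1.1), by
    obtain ⟨⟨z, w⟩, hp⟩ := p
    induction z using OnePoint.rec with
    | infty =>
      induction w using OnePoint.rec with
      | infty => simp [sphereInv, mem_Omega_coe]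
      | coe w =>
        rw [mem_Omega_infty_coe] at hp
        simp [sphereInv, hp, mem_Omega_coe]
    | coe z =>
      induction w using OnePoint.rec with
      | infty =>
        rw [mem_Omega_coe_infty] at hp
        simp [sphereInv, hp, mem_Omega_coe]
      | coe w =>
        rw [mem_Omega_coe] at hp
        by_cases hz : z = 0 <;> by_cases hw : w = 0
        · simp [sphereInv, hz, hw, mem_Omega_infty_infty]
        · simp [sphereInv, hz, hw, mem_Omega_coe_infty]
        · simp [sphereInv, hz, hw, mem_Omega_infty_coe]
        · simp only [sphereInv, hz, hw, if_false, mem_Omega_coe]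
          rw [← mul_inv]
          exact fun h1 => hp (by rw [mul_comm, ← inv_eq_one, mul_inv_rev, ← h1, mul_inv_rev,
            mul_comm])⟩

/-- Both components of a point of `Ω` lie in `ℂ`. -/
def IsFinite (p : Omega) : Prop := p.1.1 ≠ ∞ ∧ p.1.2 ≠ ∞

/-- Both components of a point of `Ω` lie in the punctured sphere (they are not `0`). -/
def IsNonzero (p : Omega) : Prop :=
  p.1.1 ≠ ((0 : ℂ) : Sphere) ∧ p.1.2 ≠ ((0 : ℂ) : Sphere)

/-- The complex number that underlies a finite point of the sphere
(with the unused value `0` at `∞`). -/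
def toComplex : Sphere → ℂ
  | .some z => z
  | ∞ => 0

lemma toComplex_mul_ne_one {q : Omega} (hq : IsFinite q) :
    toComplex q.1.1 * toComplex q.1.2 ≠ 1 := by
  obtain ⟨⟨u, v⟩, h⟩ := q
  obtain ⟨hu, hv⟩ := hq
  induction u using OnePoint.rec with
  | infty => exact absurd rfl hu
  | coe u =>
    induction v using OnePoint.rec with
    | infty => exact absurd rfl hv
    | coe v => exact (mem_Omega_coe u v).1 h

lemma isFinite_flipMap {q : Omega} (hq : IsNonzero q) : IsFinite (flipMap q) := by
  have key : ∀ z : Sphere, z ≠ ((0 : ℂ) : Sphere) → sphereInv z ≠ ∞ := by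
    intro z hz
    induction z using OnePoint.rec with
    | infty => simp [sphereInv]
    | coe z =>
      have hz' : z ≠ 0 := fun h => hz (by rw [h])
      simp [sphereInv, hz']
  exact ⟨key _ hq.2, key _ hq.1⟩

/-- The automorphism `T_{u,v}(z, w) = ((u - z) / (1 - v z), (v - w) / (1 - u w))` of `Ω`, for a
point `q = (u, v)` of `Ω` with `u, v ∈ ℂ`. -/
noncomputable def T (q : Omega) (hq : IsFinite q) (p : Omega) : Omega :=
  ⟨(psi (toComplex q.1.1) (toComplex q.1.2) p.1.1, psi (toComplex q.1.2) (toComplex q.1.1) p.1.2),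
    psi_mem_Omega (toComplex_mul_ne_one hq) p.2⟩

/-- The automorphism `(z, w) ↦ T_{1/v,1/u}(1 / w, 1 / z)` of `Ω`, for a point `q = (u, v)` of `Ω`
with `u, v ≠ 0`. -/
noncomputable def Ttilde (q : Omega) (hq : IsNonzero q) : Omega → Omega :=
  T (flipMap q) (isFinite_flipMap hq) ∘ flipMap

/-- The formula for the Poisson Fourier mode `P_n^{-m}` at a pair of complex numbers `z`, `w` with
`z w ≠ 1`. The hypergeometric series terminates, so that it is a polynomial in `z w`. -/
noncomputable def pfmFormula (n : ℤ) (m : ℕ) (x : ℂ × ℂ) : ℂ :=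
  (-1) ^ n * (m.choose n.natAbs : ℂ) * (1 - x.1 * x.2) ^ (-(m : ℤ)) *
    ordinaryHypergeometric (-(m : ℂ)) ((n.natAbs : ℂ) - m) ((n.natAbs : ℂ) + 1) (x.1 * x.2) *
    if 0 ≤ n then x.2 ^ n.natAbs else x.1 ^ n.natAbs

/-- The filter of pairs of complex numbers that tend to the point `p` of the product of two
spheres. -/
noncomputable def finiteNhds (p : Sphere × Sphere) : Filter (ℂ × ℂ) :=
  Filter.comap (fun x : ℂ × ℂ => ((x.1 : Sphere), (x.2 : Sphere))) (𝓝 p)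

/-- The Poisson Fourier mode `P_n^{-m} : Ω → ℂ`. It is given by `pfmFormula` at the points of
`Ω ∩ ℂ²`, and at the points with a component `∞` by the limit of these values, i.e. by
continuous extension. -/
noncomputable def PFM (n : ℤ) (m : ℕ) : Omega → ℂ
  | ⟨(.some z, .some w), _⟩ => pfmFormula n m (z, w)
  | ⟨p, _⟩ => Filter.limUnder (finiteNhds p) (pfmFormula n m)

lemma finiteNhds_mk (z w : Sphere) : finiteNhds (z, w) =
    (Filter.comap ((↑) : ℂ → Sphere) (𝓝 z)) ×ˢ (Filter.comap ((↑) : ℂ → Sphere) (𝓝 w)) := by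
  rw [finiteNhds, nhds_prod_eq, Filter.prod_comap_comap_eq]

lemma comap_nhds_coe (z : ℂ) : Filter.comap ((↑) : ℂ → Sphere) (𝓝 (z : Sphere)) = 𝓝 z :=
  OnePoint.comap_coe_nhds z

lemma comap_nhds_infty :
    Filter.comap ((↑) : ℂ → Sphere) (𝓝 (∞ : Sphere)) = Filter.cocompact ℂ := by
  rw [OnePoint.comap_coe_nhds_infty, Filter.coclosedCompact_eq_cocompact]

lemma comap_nhds_neBot (z : Sphere) : (Filter.comap ((↑) : ℂ → Sphere) (𝓝 z)).NeBot := by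
  induction z using OnePoint.rec with
  | infty => rw [comap_nhds_infty]; infer_instance
  | coe z => rw [comap_nhds_coe]; infer_instance

lemma finiteNhds_neBot (p : Sphere × Sphere) : (finiteNhds p).NeBot := by
  obtain ⟨z, w⟩ := p
  rw [finiteNhds_mk]
  have := comap_nhds_neBot z
  have := comap_nhds_neBot w
  infer_instance

lemma tendsto_cocompact_inv : Filter.Tendsto (fun z : ℂ => z⁻¹) (Filter.cocompact ℂ) (𝓝 0) := by
  rw [← Metric.cobounded_eq_cocompact]
  exact Filter.tendsto_inv₀_cobounded

lemma eventually_cocompact_ne_zero : ∀ᶠ z : ℂ in Filter.cocompact ℂ, z ≠ 0 := by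
  rw [← Metric.cobounded_eq_cocompact]
  exact Bornology.eventually_ne_cobounded 0

lemma tendsto_finiteNhds_infty_coe {w : ℂ} (hw : w ≠ 0) :
    Filter.Tendsto (fun x : ℂ × ℂ => (1 - x.1 * x.2)⁻¹)
      (finiteNhds ((∞ : Sphere), (w : Sphere))) (𝓝 0) ∧
    Filter.Tendsto (fun x : ℂ × ℂ => x.1 * (1 - x.1 * x.2)⁻¹)
      (finiteNhds ((∞ : Sphere), (w : Sphere))) (𝓝 (-w)⁻¹) := by
  rw [finiteNhds_mk, comap_nhds_infty, comap_nhds_coe]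
  have hz : Filter.Tendsto (fun x : ℂ × ℂ => x.1⁻¹) (Filter.cocompact ℂ ×ˢ 𝓝 w) (𝓝 0) :=
    tendsto_cocompact_inv.comp Filter.tendsto_fst
  have hw' : Filter.Tendsto (fun x : ℂ × ℂ => x.2) (Filter.cocompact ℂ ×ˢ 𝓝 w) (𝓝 w) :=
    Filter.tendsto_snd
  have hne : ∀ᶠ x : ℂ × ℂ in Filter.cocompact ℂ ×ˢ 𝓝 w, x.1 ≠ 0 :=
    Filter.tendsto_fst.eventually eventually_cocompact_ne_zero
  have h1 : Filter.Tendsto (fun x : ℂ × ℂ => (x.1⁻¹ - x.2)⁻¹) (Filter.cocompact ℂ ×ˢ 𝓝 w)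
      (𝓝 (-w)⁻¹) := by
    have := (hz.sub hw').inv₀ (by simpa using hw)
    simpa using this
  have h2 : Filter.Tendsto (fun x : ℂ × ℂ => x.1 * (1 - x.1 * x.2)⁻¹)
      (Filter.cocompact ℂ ×ˢ 𝓝 w) (𝓝 (-w)⁻¹) := by
    refine h1.congr' ?_
    filter_upwards [hne] with x hx
    have : 1 - x.1 * x.2 = x.1 * (x.1⁻¹ - x.2) := by field_simp
    rw [this, mul_inv, mul_inv_cancel_left₀ hx]
  refine ⟨?_, h2⟩
  have := hz.mul h2
  rw [zero_mul] at this
  refine this.congr' ?_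
  filter_upwards [hne] with x hx
  rw [inv_mul_cancel_left₀ hx]

lemma exists_tendsto_base {p : Sphere × Sphere} (hp : p ∈ Omega) :
    (∃ c, Filter.Tendsto (fun x : ℂ × ℂ => (1 - x.1 * x.2)⁻¹) (finiteNhds p) (𝓝 c)) ∧
    (∃ c, Filter.Tendsto (fun x : ℂ × ℂ => x.1 * (1 - x.1 * x.2)⁻¹) (finiteNhds p) (𝓝 c)) ∧
    (∃ c, Filter.Tendsto (fun x : ℂ × ℂ => x.2 * (1 - x.1 * x.2)⁻¹) (finiteNhds p) (𝓝 c)) ∧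
    (∃ c, Filter.Tendsto (fun x : ℂ × ℂ => x.1 * x.2 * (1 - x.1 * x.2)⁻¹)
      (finiteNhds p) (𝓝 c)) := by
  obtain ⟨z, w⟩ := p
  induction z using OnePoint.rec with
  | infty =>
    induction w using OnePoint.rec with
    | infty =>
      rw [finiteNhds_mk, comap_nhds_infty]
      set f : Filter (ℂ × ℂ) := Filter.cocompact ℂ ×ˢ Filter.cocompact ℂ
      have hz : Filter.Tendsto (fun x : ℂ × ℂ => x.1⁻¹) f (𝓝 0) :=
        tendsto_cocompact_inv.comp Filter.tendsto_fst
      have hw : Filter.Tendsto (fun x : ℂ × ℂ => x.2⁻¹) f (𝓝 0) :=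
        tendsto_cocompact_inv.comp Filter.tendsto_snd
      have hz0 : ∀ᶠ x : ℂ × ℂ in f, x.1 ≠ 0 :=
        Filter.tendsto_fst.eventually eventually_cocompact_ne_zero
      have hw0 : ∀ᶠ x : ℂ × ℂ in f, x.2 ≠ 0 :=
        Filter.tendsto_snd.eventually eventually_cocompact_ne_zero
      have h : Filter.Tendsto (fun x : ℂ × ℂ => (x.1⁻¹ * x.2⁻¹ - 1)⁻¹) f (𝓝 (0 * 0 - 1)⁻¹) :=
        ((hz.mul hw).sub tendsto_const_nhds).inv₀ (by norm_num)
      have key : ∀ x : ℂ × ℂ, x.1 ≠ 0 → x.2 ≠ 0 →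
          (1 - x.1 * x.2)⁻¹ = x.1⁻¹ * x.2⁻¹ * (x.1⁻¹ * x.2⁻¹ - 1)⁻¹ := by
        intro x h1 h2
        rw [← mul_inv, ← mul_inv]
        congr 1
        field_simp
      refine ⟨⟨_, ((hz.mul hw).mul h).congr' ?_⟩, ⟨_, (hw.mul h).congr' ?_⟩,
        ⟨_, (hz.mul h).congr' ?_⟩, ⟨_, h.congr' ?_⟩⟩ <;>
      · filter_upwards [hz0, hw0] with x h1 h2
        rw [key x h1 h2]
        try field_simp
    | coe w =>
      obtain ⟨h1, h2⟩ := tendsto_finiteNhds_infty_coe ((mem_Omega_infty_coe w).1 hp)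
      have hw : Filter.Tendsto (fun x : ℂ × ℂ => x.2)
          (finiteNhds ((∞ : Sphere), (w : Sphere))) (𝓝 w) := by
        rw [finiteNhds_mk, comap_nhds_coe]
        exact Filter.tendsto_snd
      refine ⟨⟨_, h1⟩, ⟨_, h2⟩, ⟨_, hw.mul h1⟩, ⟨_, (hw.mul h2).congr fun x => ?_⟩⟩
      ring
  | coe z =>
    induction w using OnePoint.rec with
    | infty =>
      obtain ⟨h1, h2⟩ := tendsto_finiteNhds_infty_coe ((mem_Omega_coe_infty z).1 hp)
      have hs : Filter.Tendsto Prod.swap (finiteNhds ((z : Sphere), (∞ : Sphere)))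
          (finiteNhds ((∞ : Sphere), (z : Sphere))) := by
        rw [finiteNhds_mk, finiteNhds_mk]
        exact Filter.tendsto_snd.prodMk Filter.tendsto_fst
      have hz : Filter.Tendsto (fun x : ℂ × ℂ => x.1)
          (finiteNhds ((z : Sphere), (∞ : Sphere))) (𝓝 z) := by
        rw [finiteNhds_mk, comap_nhds_coe]
        exact Filter.tendsto_fst
      have h1' := h1.comp hs
      have h2' := h2.comp hs
      refine ⟨⟨_, h1'.congr fun x => ?_⟩, ⟨_, (hz.mul h1').congr fun x => ?_⟩,
        ⟨_, h2'.congr fun x => ?_⟩, ⟨_, (hz.mul h2').congr fun x => ?_⟩⟩ <;>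
      · simp only [Function.comp, Prod.fst_swap, Prod.snd_swap, mul_comm x.2 x.1]
        try ring
    | coe w =>
      have h0 : 1 - z * w ≠ 0 :=
        fun h => (mem_Omega_coe z w).1 hp (by linear_combination -h)
      rw [finiteNhds_mk, comap_nhds_coe, comap_nhds_coe, ← nhds_prod_eq]
      have h : ContinuousAt (fun x : ℂ × ℂ => (1 - x.1 * x.2)⁻¹) (z, w) :=
        ContinuousAt.inv₀ (by fun_prop) h0
      exact ⟨⟨_, h⟩, ⟨_, continuousAt_fst.mul h⟩, ⟨_, continuousAt_snd.mul h⟩,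
        ⟨_, (continuousAt_fst.mul continuousAt_snd).mul h⟩⟩

/-- The limits in the definition of `PFM` exist. -/
lemma exists_tendsto_pfmFormula (n : ℤ) (m : ℕ) {p : Sphere × Sphere} (hp : p ∈ Omega) :
    ∃ c, Filter.Tendsto (pfmFormula n m) (finiteNhds p) (𝓝 c) := by
  obtain ⟨⟨c₀, h₀⟩, ⟨c₁, h₁⟩, ⟨c₂, h₂⟩, ⟨c₃, h₃⟩⟩ := exists_tendsto_base hp
  set N := n.natAbs with hN
  by_cases hm : m < N
  · refine ⟨0, tendsto_const_nhds.congr fun x => ?_⟩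
    simp [pfmFormula, ← hN, Nat.choose_eq_zero_of_lt hm]
  obtain ⟨d, rfl⟩ : ∃ d, m = N + d := ⟨m - N, by omega⟩
  have hF : ∀ t : ℂ, ordinaryHypergeometric (-((N + d : ℕ) : ℂ)) ((N : ℂ) - (N + d : ℕ))
      ((N : ℂ) + 1) t = ∑ k ∈ Finset.range (d + 1), ordinaryHypergeometricSeries ℂ
        (-((N + d : ℕ) : ℂ)) ((N : ℂ) - (N + d : ℕ)) ((N : ℂ) + 1) k (fun _ => (1 : ℂ)) *
          t ^ k := by
    intro t
    rw [ordinaryHypergeometric, FormalMultilinearSeries.sum, tsum_eq_sum (s := Finset.range (d + 1))]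
    · refine Finset.sum_congr rfl fun k _ => ?_
      rw [ordinaryHypergeometricSeries_apply_eq, ordinaryHypergeometricSeries_apply_eq]
      simp
    · intro k hk
      rw [ordinaryHypergeometricSeries_eq_zero_of_neg_nat (k := d)]
      · rfl
      · right; left; push_cast; ring
      · simpa using hk
  set a : ℕ → ℂ := fun k => ordinaryHypergeometricSeries ℂ
        (-((N + d : ℕ) : ℂ)) ((N : ℂ) - (N + d : ℕ)) ((N : ℂ) + 1) k (fun _ => (1 : ℂ))
  have hlim : ∀ (g : ℂ × ℂ → ℂ) (c : ℂ),
      Filter.Tendsto (fun x => g x * (1 - x.1 * x.2)⁻¹) (finiteNhds p) (𝓝 c) →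
      ∃ c', Filter.Tendsto (fun x : ℂ × ℂ => (-1) ^ n * ((N + d).choose N : ℂ) *
        (1 - x.1 * x.2) ^ (-((N + d : ℕ) : ℤ)) *
        (∑ k ∈ Finset.range (d + 1), a k * (x.1 * x.2) ^ k) * g x ^ N) (finiteNhds p) (𝓝 c') := by
    intro g c hg
    refine ⟨_, ((tendsto_finsetSum (Finset.range (d + 1)) fun k _ =>
      (((h₃.pow k).mul (h₀.pow (d - k))).const_mul (a k))).mul (hg.pow N)).const_mul
        ((-1) ^ n * ((N + d).choose N : ℂ)) |>.congr fun x => ?_⟩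
    rw [zpow_neg, zpow_natCast, ← inv_pow]
    simp only [Finset.sum_mul, Finset.mul_sum]
    refine Finset.sum_congr rfl fun k hk => ?_
    obtain ⟨e, rfl⟩ : ∃ e, d = k + e := ⟨d - k, by have := Finset.mem_range.1 hk; omega⟩
    rw [Nat.add_sub_cancel_left]
    ring
  by_cases hn : 0 ≤ n
  · obtain ⟨c', hc⟩ := hlim (fun x => x.2) c₂ h₂
    refine ⟨c', hc.congr fun x => ?_⟩
    rw [pfmFormula, ← hN, hF, if_pos hn]
  · obtain ⟨c', hc⟩ := hlim (fun x => x.1) c₁ h₁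
    refine ⟨c', hc.congr fun x => ?_⟩
    rw [pfmFormula, ← hN, hF, if_neg hn]

/-- The normalized Poisson Fourier mode
`Y_n^{-m} = √(2m+1) · binom(m, |n|)^{-1/2} · binom(-m-1, |n|)^{1/2} · P_n^{-m}`, for `|n| ≤ m`,
with principal values of the powers and the generalized binomial coefficient
`binom(-m-1, k) = (-1)^k binom(m+k, k)`. -/
noncomputable def Y (n : ℤ) (m : ℕ) (p : Omega) : ℂ :=
  (√(2 * m + 1 : ℝ) : ℂ) * (m.choose n.natAbs : ℂ) ^ (-(1 / 2) : ℂ) *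
    ((Ring.choose (-(m : ℤ) - 1) n.natAbs : ℤ) : ℂ) ^ (1 / 2 : ℂ) * PFM n m p

/-- The complex zonal harmonic of degree `m`. -/
noncomputable def Z (m : ℕ) (p q : Omega) : ℂ :=
  ∑ j ∈ Finset.Icc (-(m : ℤ)) (m : ℤ), Y j m p * Y (-j) m q

end ComplexZonal

/-!
Zonal harmonics as an invariant pairing of binary forms.

In homogeneous coordinates `z = (a : b)`, `w = (c : d)`, the mode `P_n^{-m}` is, up to the sign
`(-1)^n` and the factor `(b d - a c)^{-m}`, the coefficient of `t ^ (m + n)` in the binary form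
`(b t + a) ^ m (c t + d) ^ m` of degree `2 m` (`PFM_eq`). For complex `z`, `w` this is the
expansion of the terminating hypergeometric series (`pfmFormula_eq`). The coordinate formula is
continuous up to the points with a component `∞`, so it also computes the limits defining `PFM`
there.

The normalizing constants of `Y_j Y_{-j}` multiply to
`(2 m + 1) (-1)^j binom(2m, m) / binom(2m, m + j)` (`Y_mul_Y_neg`), which are, up to a common
factor, the weights of the `SL₂`-invariant pairing of binary forms of degree `2 m`. Pairing with a
power `(f t + e) ^ (2 m)` of a linear form is, up to scaling, evaluation at the zero of that form.
The form `(f t + e) ^ m (g t + h) ^ m` is a multiple of the coefficient of `x ^ m` in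
`((f t + e) + x (g t + h)) ^ (2 m)`, so pairing with it amounts to evaluating at a point depending
on `x` and taking the coefficient of `x ^ m`. The result is the middle coefficient of the form
attached to another point, whose coordinates are the determinants of the coordinates of
`(z, w)` and `(u, v)` (`sum_formCoeff_mul_formCoeff`). This point is `T_{u,v}(z, w)`, and
`T̃_{u,v}(z, w)` is the same point with its components exchanged, which does not change `P_0^{-m}`.
Since all coordinates are homogeneous, finite and infinite points need no separate treatment.
-/

namespace ComplexZonal
open Polynomial

/-! ### Binary forms with two roots of equal multiplicity -/

variable {R : Type*} [CommRing R]

lemma coeff_linear_pow (p q : R) (n k : ℕ) :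
    ((C q * X + C p) ^ n).coeff k = q ^ k * p ^ (n - k) * (n.choose k : R) := by
  rw [add_pow, finsetSum_coeff]
  have : ∀ j ∈ Finset.range (n + 1), ((C q * X) ^ j * C p ^ (n - j) * (n.choose j : R[X])).coeff k
      = if k = j then q ^ k * p ^ (n - k) * (n.choose k : R) else 0 := by
    intro j _
    rw [mul_pow, ← C_pow, ← C_pow, ← C_eq_natCast, coeff_mul_C, coeff_mul_C, coeff_C_mul_X_pow]
    split_ifs with h
    · rw [h]
    · simp
  rw [Finset.sum_congr rfl this, Finset.sum_ite_eq]
  split_ifs with h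
  · rfl
  · rw [Nat.choose_eq_zero_of_lt (by simpa using h)]; simp

/-- The binary form `(b t + a) ^ m (c t + d) ^ m` of degree `2 m`, dehomogenized. It is attached to
the points `(a : b)` and `(c : d)`; the order of the coordinates in the second factor is
reversed. -/
noncomputable def formPoly (m : ℕ) (a b c d : R) : R[X] :=
  (C b * X + C a) ^ m * (C c * X + C d) ^ m

/-- The coefficient of `t ^ i` in `formPoly m a b c d`. -/
noncomputable def formCoeff (m : ℕ) (a b c d : R) (i : ℕ) : R := (formPoly m a b c d).coeff i

lemma formCoeff_eq_sum (m : ℕ) (a b c d : R) (i : ℕ) :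
    formCoeff m a b c d i = ∑ x ∈ Finset.HasAntidiagonal.antidiagonal i,
      (b ^ x.1 * a ^ (m - x.1) * (m.choose x.1 : R)) *
        (c ^ x.2 * d ^ (m - x.2) * (m.choose x.2 : R)) := by
  simp only [formCoeff, formPoly, coeff_mul, coeff_linear_pow]

lemma formCoeff_smul (m : ℕ) (s r a b c d : R) (i : ℕ) :
    formCoeff m (s * a) (s * b) (r * c) (r * d) i = (s * r) ^ m * formCoeff m a b c d i := by
  have : formPoly m (s * a) (s * b) (r * c) (r * d) = C ((s * r) ^ m) * formPoly m a b c d := by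
    simp only [formPoly, C_mul, C_pow]
    rw [← mul_pow, ← mul_pow, ← mul_pow]
    congr 1
    ring
  rw [formCoeff, this, coeff_C_mul, formCoeff]

lemma natDegree_linear_pow_le (a b : R) (m : ℕ) : ((C b * X + C a) ^ m).natDegree ≤ m := by
  simpa using natDegree_pow_le_of_le m (natDegree_linear_le (a := b) (b := a))

lemma reflect_linear_pow (a b : R) (m : ℕ) :
    reflect m ((C b * X + C a) ^ m) = (C a * X + C b) ^ m := by
  ext k
  rw [coeff_reflect, coeff_linear_pow, coeff_linear_pow]
  by_cases h : k ≤ m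
  · rw [revAt_le h, Nat.choose_symm h, Nat.sub_sub_self h]
    ring
  · rw [revAt_eq_self_of_lt (by omega), Nat.choose_eq_zero_of_lt (by omega)]
    simp

/-- Reversal `t ↦ 1 / t` of the form inverts the points to which it is attached. -/
lemma formCoeff_reverse (m : ℕ) (a b c d : R) {i : ℕ} (hi : i ≤ 2 * m) :
    formCoeff m a b c d (2 * m - i) = formCoeff m b a d c i := by
  have h := reflect_mul ((C b * X + C a) ^ m) ((C c * X + C d) ^ m)
    (natDegree_linear_pow_le a b m) (natDegree_linear_pow_le d c m)
  rw [reflect_linear_pow, reflect_linear_pow] at h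
  have h' := congrArg (fun P => P.coeff i) h
  simp only [coeff_reflect] at h'
  rw [← two_mul, revAt_le hi] at h'
  rw [formCoeff, formPoly, h', formCoeff, formPoly]

lemma formCoeff_swap_middle (m : ℕ) (a b c d : R) :
    formCoeff m a b c d m = formCoeff m c d a b m := by
  have h := formCoeff_reverse m a b c d (i := m) (by omega)
  rw [show 2 * m - m = m by omega] at h
  rw [h, formCoeff, formPoly, mul_comm]
  rfl

/-- The homogenization, of degree `2 m`, of `formPoly m a b c d` at `(t, s)`. The individual factors
may have degree less than `m`, when `b = 0` or `c = 0`. -/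
lemma sum_formCoeff {A : Type*} [CommRing A] [Algebra R A] (m : ℕ) (a b c d : R) (t s : A) :
    ∑ i ∈ Finset.range (2 * m + 1), algebraMap R A (formCoeff m a b c d i) * t ^ i * s ^ (2 * m - i)
      = (algebraMap R A b * t + algebraMap R A a * s) ^ m *
        (algebraMap R A c * t + algebraMap R A d * s) ^ m := by
  have hom : ∀ x y : R, (MvPolynomial.C x * MvPolynomial.X 0 + MvPolynomial.C y * MvPolynomial.X 1 :
      MvPolynomial (Fin 2) R).IsHomogeneous 1 := fun x y =>
    ((MvPolynomial.isHomogeneous_X R 0).C_mul x).add ((MvPolynomial.isHomogeneous_X R 1).C_mul y)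
  have hq : ((MvPolynomial.C b * MvPolynomial.X 0 + MvPolynomial.C a * MvPolynomial.X 1) ^ m *
      (MvPolynomial.C c * MvPolynomial.X 0 + MvPolynomial.C d * MvPolynomial.X 1) ^ m :
      MvPolynomial (Fin 2) R).IsHomogeneous (2 * m) := by
    have := ((hom b a).pow m).mul ((hom c d).pow m)
    rwa [one_mul, ← two_mul] at this
  have h := homogenize_eq_of_isHomogeneous (p := formPoly m a b c d) hq (by
    simp only [map_mul, map_pow, map_add, MvPolynomial.aeval_C, MvPolynomial.aeval_X, formPoly,
      algebraMap_eq, Matrix.cons_val_zero, Matrix.cons_val_one, mul_one])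
  have h' := congrArg (MvPolynomial.aeval ![t, s]) h
  rw [homogenize, map_sum, Finset.Nat.sum_antidiagonal_eq_sum_range_succ_mk] at h'
  simp only [MvPolynomial.aeval_monomial] at h'
  convert h' using 1
  · refine Finset.sum_congr rfl fun i _ => ?_
    rw [Finsupp.update_eq_add_single (by simp), Finsupp.prod_add_index' (by simp)
      (by simp [pow_add])]
    simp [formCoeff, mul_assoc]
  · simp

lemma coeff_coeff_swap (P : R[X][X]) (i j : ℕ) :
    ((Bivariate.swap P).coeff i).coeff j = (P.coeff j).coeff i := by
  induction P using Polynomial.induction_on' with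
  | add p q hp hq => simp [hp, hq]
  | monomial n f =>
    induction f using Polynomial.induction_on' with
    | add p q hp hq => simp_all [map_add]
    | monomial k r =>
      rw [Bivariate.swap_monomial_monomial]
      simp only [coeff_monomial]
      split_ifs <;> simp_all [coeff_monomial]

/-- Both sides are the coefficient of `t ^ i x ^ m` in `((f t + e) + x (g t + h)) ^ (2 m)`,
expanded in powers of `x` on the left and in powers of `t` on the right. -/
lemma choose_mul_formCoeff (m : ℕ) (e f g h : R) (i : ℕ) :
    ((2 * m).choose m : R) * formCoeff m e f g h i =
      ((2 * m).choose i : R) *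
        ((C g * X + C f) ^ i * (C h * X + C e) ^ (2 * m - i)).coeff m := by
  have hs : Bivariate.swap ((C (C g * X + C h : R[X]) * X + C (C f * X + C e)) ^ (2 * m)) =
      (C (C g * X + C f : R[X]) * X + C (C h * X + C e)) ^ (2 * m) := by
    have : Bivariate.swap (C (C g * X + C h : R[X]) * X + C (C f * X + C e)) =
        C (C g * X + C f : R[X]) * X + C (C h * X + C e) := by
      simp only [map_add, map_mul, Bivariate.swap_X, Bivariate.swap_Y, Bivariate.swap_C_C]
      ring
    rw [map_pow, this]
  -- `C X` is the variable `t` of the form, and the outer variable `X` is `x`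
  have h1 := coeff_coeff_swap
    ((C (C g * X + C h : R[X]) * X + C (C f * X + C e)) ^ (2 * m)) i m
  rw [hs, coeff_linear_pow, coeff_linear_pow, ← C_eq_natCast, ← C_eq_natCast, coeff_mul_C,
    coeff_mul_C, show 2 * m - m = m by omega] at h1
  rw [formCoeff, formPoly, mul_comm ((C f * X + C e) ^ m), mul_comm ((2 * m).choose m : R), ← h1,
    mul_comm]

/-- The invariant pairing of two forms: the coefficient of `x ^ m` in the homogenization of the
first form at `(-(h x + e), g x + f)`. -/
theorem sum_formCoeff_mul_formCoeff {K : Type*} [Field K] [CharZero K] (m : ℕ)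
    (a b c d e f g h : K) :
    ∑ i ∈ Finset.range (2 * m + 1), (-1) ^ i * (((2 * m).choose m : K) / ((2 * m).choose i : K)) *
        formCoeff m a b c d i * formCoeff m e f g h (2 * m - i) =
      formCoeff m (a * f - b * e) (a * g - b * h) (d * g - c * h) (d * f - c * e) m := by
  -- `-(h x + e) / (g x + f)` is the zero in `t` of the linear form `(f t + e) + x (g t + h)`
  have key := congrArg (fun P : K[X] => P.coeff m)
    (sum_formCoeff m a b c d (-(C h * X + C e)) (C g * X + C f))
  simp only [finsetSum_coeff, algebraMap_eq] at key
  convert key using 1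
  · refine Finset.sum_congr rfl fun i hi => ?_
    have hi : i ≤ 2 * m := by simpa [Nat.lt_succ_iff] using hi
    have h0 : ((2 * m).choose i : K) ≠ 0 := by
      exact_mod_cast (Nat.choose_pos hi).ne'
    have hA := choose_mul_formCoeff m e f g h (2 * m - i)
    rw [Nat.choose_symm hi, Nat.sub_sub_self hi] at hA
    have : C (formCoeff m a b c d i) * (-(C h * X + C e)) ^ i * (C g * X + C f) ^ (2 * m - i) =
        C (formCoeff m a b c d i * (-1) ^ i) *
          ((C g * X + C f) ^ (2 * m - i) * (C h * X + C e) ^ i) := by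
      rw [neg_pow]; simp only [C_mul, C_pow, C_neg, C_1]; ring
    rw [this, coeff_C_mul, ← mul_right_inj' h0, mul_left_comm _ _ (coeff _ _), ← hA]
    field_simp
  · rw [formCoeff, formPoly]
    congr 3
    · simp only [C_sub, C_mul]; ring
    · simp only [C_sub, C_mul]; ring

/-! ### Hypergeometric expansion at finite points -/

lemma cast_add_choose_mul_factorial (i j : ℕ) :
    ((i + j).choose i : ℂ) * i.factorial * j.factorial = (i + j).factorial := by
  have h := Nat.choose_mul_factorial_mul_factorial (Nat.le_add_right i j)
  rw [Nat.add_sub_cancel_left] at h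
  exact_mod_cast h

lemma choose_mul_hypergeometric_coeff (N d : ℕ) {k : ℕ} (hk : k ≤ d) :
    ((N + d).choose N : ℂ) * ((k.factorial : ℂ)⁻¹ * (ascPochhammer ℂ k).eval (-((N + d : ℕ) : ℂ)) *
      (ascPochhammer ℂ k).eval ((N : ℂ) - (N + d : ℕ)) *
      ((ascPochhammer ℂ k).eval ((N : ℂ) + 1))⁻¹) =
    ((N + d).choose k : ℂ) * ((N + d).choose (N + k) : ℂ) := by
  obtain ⟨e, rfl⟩ := Nat.exists_eq_add_of_le hk
  rw [show (N : ℂ) - (N + (k + e) : ℕ) = -((k + e : ℕ) : ℂ) by push_cast; ring,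
    ascPochhammer_eval_neg_eq_descPochhammer, ascPochhammer_eval_neg_eq_descPochhammer,
    descPochhammer_eval_eq_descFactorial, descPochhammer_eval_eq_descFactorial,
    show (N : ℂ) + 1 = ((N + 1 : ℕ) : ℂ) by push_cast; rfl,
    ascPochhammer_nat_eq_natCast_ascFactorial]
  have h1 : (-1 : ℂ) ^ k * (-1) ^ k = 1 := by rw [← mul_pow]; simp
  have h2 : ((N + (k + e)).descFactorial k : ℂ) =
      (k.factorial : ℂ) * ((N + (k + e)).choose k : ℂ) := by
    exact_mod_cast Nat.descFactorial_eq_factorial_mul_choose _ _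
  have h3 : (e.factorial : ℂ) * ((k + e).descFactorial k : ℂ) = ((k + e).factorial : ℂ) := by
    have := Nat.factorial_mul_descFactorial (Nat.le_add_right k e)
    rw [Nat.add_sub_cancel_left] at this
    exact_mod_cast this
  have h4 : (N.factorial : ℂ) * ((N + 1).ascFactorial k : ℂ) = ((N + k).factorial : ℂ) := by
    exact_mod_cast Nat.factorial_mul_ascFactorial N k
  have h5 : ((N + (k + e)).choose N : ℂ) * N.factorial * (k + e).factorial =
      (N + (k + e)).factorial := by
    exact cast_add_choose_mul_factorial N (k + e)
  have h6 : ((N + (k + e)).choose (N + k) : ℂ) * (N + k).factorial * e.factorial =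
      (N + (k + e)).factorial := by
    rw [← add_assoc]
    exact cast_add_choose_mul_factorial (N + k) e
  have n1 : (k.factorial : ℂ) ≠ 0 := by exact_mod_cast k.factorial_ne_zero
  have n2 : (N.factorial : ℂ) ≠ 0 := by exact_mod_cast N.factorial_ne_zero
  have n3 : (e.factorial : ℂ) ≠ 0 := by exact_mod_cast e.factorial_ne_zero
  have n4 : ((N + 1).ascFactorial k : ℂ) ≠ 0 := by
    exact_mod_cast (Nat.ascFactorial_pos N k).ne'
  have main : ((N + (k + e)).choose N : ℂ) * ((k + e).descFactorial k : ℂ) =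
      ((N + (k + e)).choose (N + k) : ℂ) * ((N + 1).ascFactorial k : ℂ) := by
    apply mul_left_cancel₀ (mul_ne_zero n2 n3)
    rw [← h4] at h6
    rw [← h3, ← h6] at h5
    linear_combination h5
  rw [h2]
  field_simp
  linear_combination ((N + (k + e)).choose k : ℂ) *
    (((N + (k + e)).choose N : ℂ) * ((k + e).descFactorial k : ℂ) * h1 + main)

lemma choose_mul_ordinaryHypergeometric (N d : ℕ) (t : ℂ) :
    ((N + d).choose N : ℂ) * ordinaryHypergeometric (-((N + d : ℕ) : ℂ)) ((N : ℂ) - (N + d : ℕ))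
      ((N : ℂ) + 1) t = ∑ k ∈ Finset.range (d + 1),
        ((N + d).choose k : ℂ) * ((N + d).choose (N + k) : ℂ) * t ^ k := by
  rw [ordinaryHypergeometric, FormalMultilinearSeries.sum, tsum_eq_sum (s := Finset.range (d + 1)),
    Finset.mul_sum]
  · refine Finset.sum_congr rfl fun k hk => ?_
    rw [ordinaryHypergeometricSeries_apply_eq, smul_eq_mul, ← mul_assoc,
      choose_mul_hypergeometric_coeff N d (Nat.lt_succ_iff.1 (Finset.mem_range.1 hk))]
  · intro k hk
    rw [ordinaryHypergeometricSeries_eq_zero_of_neg_nat (k := d)]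
    · rfl
    · right; left; push_cast; ring
    · simpa using hk

/-- The coefficients below the middle; those above follow by `formCoeff_reverse`. -/
lemma formCoeff_below_middle (N d : ℕ) (z w : ℂ) :
    formCoeff (N + d) z 1 w 1 d = (∑ k ∈ Finset.range (d + 1),
      ((N + d).choose k : ℂ) * ((N + d).choose (N + k) : ℂ) * (z * w) ^ k) * z ^ N := by
  rw [formCoeff_eq_sum, ← Finset.Nat.sum_antidiagonal_swap,
    Finset.Nat.sum_antidiagonal_eq_sum_range_succ_mk, Finset.sum_mul]
  refine Finset.sum_congr rfl fun k hk => ?_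
  obtain ⟨e, rfl⟩ := Nat.exists_eq_add_of_le (Nat.lt_succ_iff.1 (Finset.mem_range.1 hk))
  have h1 : N + (k + e) - e = N + k := by omega
  have h2 : (N + (k + e)).choose e = (N + (k + e)).choose (N + k) :=
    (Nat.choose_symm_of_eq_add (by omega))
  simp only [Prod.fst_swap, Prod.snd_swap, Nat.add_sub_cancel_left, h1, h2]
  ring

theorem pfmFormula_eq (n : ℤ) (m : ℕ) (hn : n.natAbs ≤ m) (x : ℂ × ℂ) :
    pfmFormula n m x = (-1) ^ n * (1 - x.1 * x.2) ^ (-(m : ℤ)) *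
      formCoeff m x.1 1 x.2 1 (m + n).toNat := by
  obtain ⟨d, rfl⟩ := Nat.exists_eq_add_of_le hn
  set N := n.natAbs with hN
  have hF := choose_mul_ordinaryHypergeometric N d (x.1 * x.2)
  have key : (∑ k ∈ Finset.range (d + 1),
        ((N + d).choose k : ℂ) * ((N + d).choose (N + k) : ℂ) * (x.1 * x.2) ^ k) *
      (if 0 ≤ n then x.2 ^ N else x.1 ^ N) =
        formCoeff (N + d) x.1 1 x.2 1 ((N + d : ℕ) + n).toNat := by
    split_ifs with h
    · have : ((N + d : ℕ) + n).toNat = 2 * (N + d) - d := by omega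
      rw [this, formCoeff_reverse _ _ _ _ _ (by omega)]
      have h' := formCoeff_below_middle N d x.2 x.1
      rw [mul_comm x.2] at h'
      rw [← h', formCoeff, formPoly, mul_comm, formCoeff, formPoly]
    · have : ((N + d : ℕ) + n).toNat = d := by omega
      rw [this, formCoeff_below_middle]
  rw [← key, ← hF, pfmFormula, ← hN]
  ring

/-! ### Homogeneous coordinates and continuous extension -/

/-- `(a : b)` are homogeneous coordinates of the point `z = a / b` of the Riemann sphere, where
`z = ∞` if `b = 0`. -/
def IsCoord (z : Sphere) (a b : ℂ) : Prop :=
  (b ≠ 0 ∧ z = ((a / b : ℂ) : Sphere)) ∨ (b = 0 ∧ a ≠ 0 ∧ z = ∞)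

lemma isCoord_coe (z : ℂ) : IsCoord z z 1 := by simp [IsCoord]

lemma isCoord_infty : IsCoord ∞ 1 0 := by simp [IsCoord]

lemma exists_isCoord (z : Sphere) : ∃ a b, IsCoord z a b := by
  induction z using OnePoint.rec with
  | infty => exact ⟨1, 0, isCoord_infty⟩
  | coe z => exact ⟨z, 1, isCoord_coe z⟩

lemma IsCoord.smul {z : Sphere} {a b : ℂ} (h : IsCoord z a b) {s : ℂ} (hs : s ≠ 0) :
    IsCoord z (s * a) (s * b) := by
  rcases h with ⟨hb, rfl⟩ | ⟨hb, ha, rfl⟩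
  · exact Or.inl ⟨mul_ne_zero hs hb, by rw [mul_div_mul_left _ _ hs]⟩
  · exact Or.inr ⟨by simp [hb], mul_ne_zero hs ha, rfl⟩

lemma IsCoord.exists_coe {z a b : ℂ} (h : IsCoord z a b) : ∃ s, s ≠ 0 ∧ a = s * z ∧ b = s * 1 := by
  rcases h with ⟨hb, h⟩ | ⟨_, _, h⟩
  · rw [OnePoint.coe_eq_coe] at h
    exact ⟨b, hb, by rw [h]; field_simp, by simp⟩
  · exact absurd h (OnePoint.coe_ne_infty z)

lemma IsCoord.exists_infty {a b : ℂ} (h : IsCoord ∞ a b) : ∃ s, s ≠ 0 ∧ a = s * 1 ∧ b = s * 0 := by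
  rcases h with ⟨_, h⟩ | ⟨hb, ha, _⟩
  · exact absurd h.symm (OnePoint.coe_ne_infty _)
  · exact ⟨a, ha, by simp, by simp [hb]⟩

/-- Coordinates of `z` extend continuously to the complex numbers near `z`. -/
lemma IsCoord.exists_tendsto {z : Sphere} {a b : ℂ} (h : IsCoord z a b) :
    ∃ A B : ℂ → ℂ, Filter.Tendsto A (Filter.comap (↑) (𝓝 z)) (𝓝 a) ∧
      Filter.Tendsto B (Filter.comap (↑) (𝓝 z)) (𝓝 b) ∧
      ∀ᶠ x : ℂ in Filter.comap (↑) (𝓝 z), IsCoord x (A x) (B x) := by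
  induction z using OnePoint.rec with
  | infty =>
    obtain ⟨s, hs, rfl, rfl⟩ := h.exists_infty
    rw [comap_nhds_infty]
    -- near `∞` the coordinates `(x : 1)` are rescaled to `(1 : x⁻¹)`
    refine ⟨fun _ => s * 1, fun x => s * x⁻¹, tendsto_const_nhds,
      tendsto_cocompact_inv.const_mul s, ?_⟩
    filter_upwards [eventually_cocompact_ne_zero] with x hx
    have := (isCoord_coe x).smul (inv_ne_zero hx)
    rw [inv_mul_cancel₀ hx, mul_one] at this
    exact this.smul hs
  | coe z =>
    obtain ⟨s, hs, rfl, rfl⟩ := h.exists_coe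
    rw [comap_nhds_coe]
    exact ⟨fun x => s * x, fun _ => s * 1, Filter.tendsto_id.const_mul s, tendsto_const_nhds,
      Filter.Eventually.of_forall fun x => (isCoord_coe x).smul hs⟩

/-- `Ω` is the nonvanishing locus of a bihomogeneous form; the convention `∞ · 0 = 1` makes this
hold at the infinite points as well. -/
lemma det_ne_zero {p : Sphere × Sphere} (hp : p ∈ Omega) {a b c d : ℂ} (h1 : IsCoord p.1 a b)
    (h2 : IsCoord p.2 c d) : b * d - a * c ≠ 0 := by
  obtain ⟨z, w⟩ := p
  rcases h1 with ⟨hb, rfl⟩ | ⟨rfl, ha, rfl⟩ <;> rcases h2 with ⟨hd, rfl⟩ | ⟨rfl, hc, rfl⟩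
  · rw [mem_Omega_coe, div_mul_div_comm, Ne, div_eq_one_iff_eq (mul_ne_zero hb hd)] at hp
    exact sub_ne_zero.2 (Ne.symm hp)
  · rw [mem_Omega_coe_infty] at hp
    have : a ≠ 0 := fun h => hp (by simp [h])
    simp [this, hc]
  · rw [mem_Omega_infty_coe] at hp
    have : c ≠ 0 := fun h => hp (by simp [h])
    simp [this, ha]
  · simp [ha, hc]

lemma continuous_formCoeff (m i : ℕ) :
    Continuous fun x : (ℂ × ℂ) × ℂ × ℂ => formCoeff m x.1.1 x.1.2 x.2.1 x.2.2 i := by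
  simp only [formCoeff_eq_sum]
  fun_prop

lemma pfmFormula_of_isCoord (n : ℤ) (m : ℕ) (hn : n.natAbs ≤ m) {x y a b c d : ℂ}
    (h1 : IsCoord x a b) (h2 : IsCoord y c d) :
    pfmFormula n m (x, y) =
      (-1) ^ n * (b * d - a * c) ^ (-(m : ℤ)) * formCoeff m a b c d (m + n).toNat := by
  obtain ⟨s, hs, rfl, rfl⟩ := h1.exists_coe
  obtain ⟨r, hr, rfl, rfl⟩ := h2.exists_coe
  rw [pfmFormula_eq n m hn, formCoeff_smul,
    show s * 1 * (r * 1) - s * x * (r * y) = s * r * (1 - x * y) by ring, mul_zpow,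
    zpow_neg (s * r), zpow_natCast]
  field_simp

/-- The Poisson Fourier modes in homogeneous coordinates, at all points of `Ω`. -/
theorem PFM_eq (n : ℤ) (m : ℕ) (hn : n.natAbs ≤ m) (p : Omega) {a b c d : ℂ}
    (h1 : IsCoord p.1.1 a b) (h2 : IsCoord p.1.2 c d) :
    PFM n m p =
      (-1) ^ n * (b * d - a * c) ^ (-(m : ℤ)) * formCoeff m a b c d (m + n).toNat := by
  obtain ⟨⟨z, w⟩, hp⟩ := p
  have hD : b * d - a * c ≠ 0 := det_ne_zero hp h1 h2
  have hlim : Filter.limUnder (finiteNhds (z, w)) (pfmFormula n m) =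
      (-1) ^ n * (b * d - a * c) ^ (-(m : ℤ)) * formCoeff m a b c d (m + n).toNat := by
    have := finiteNhds_neBot (z, w)
    refine Filter.Tendsto.limUnder_eq ?_
    obtain ⟨A, B, hA, hB, hAB⟩ := h1.exists_tendsto
    obtain ⟨C', D, hC, hD', hCD⟩ := h2.exists_tendsto
    rw [finiteNhds_mk]
    replace hA := hA.comp (Filter.tendsto_fst (g := Filter.comap ((↑) : ℂ → Sphere) (𝓝 w)))
    replace hB := hB.comp (Filter.tendsto_fst (g := Filter.comap ((↑) : ℂ → Sphere) (𝓝 w)))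
    replace hC := hC.comp (Filter.tendsto_snd (f := Filter.comap ((↑) : ℂ → Sphere) (𝓝 z)))
    replace hD' := hD'.comp (Filter.tendsto_snd (f := Filter.comap ((↑) : ℂ → Sphere) (𝓝 z)))
    have hF := ((continuous_formCoeff m (m + n).toNat).tendsto ((a, b), (c, d))).comp
      ((hA.prodMk_nhds hB).prodMk_nhds (hC.prodMk_nhds hD'))
    have hZ := (((hB.mul hD').sub (hA.mul hC)).zpow₀ (-(m : ℤ)) (Or.inl hD)).const_mul
      ((-1 : ℂ) ^ n)
    refine (hZ.mul hF).congr' ?_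
    filter_upwards [hAB.prod_mk hCD] with x hx
    exact (pfmFormula_of_isCoord n m hn hx.1 hx.2).symm
  induction z using OnePoint.rec with
  | infty => exact hlim
  | coe z =>
    induction w using OnePoint.rec with
    | infty => exact hlim
    | coe w => exact pfmFormula_of_isCoord n m hn h1 h2

/-! ### Normalizing constants -/

lemma ring_choose_neg_sub_one (m N : ℕ) :
    Ring.choose (-(m : ℤ) - 1) N = (-1) ^ N * ((m + N).choose N : ℤ) := by
  rw [show -(m : ℤ) - 1 = -((m : ℤ) + 1) by ring, Ring.choose_neg,
    show (m : ℤ) + 1 + N - 1 = ((m + N : ℕ) : ℤ) by push_cast; ring, Ring.choose_natCast,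
    Int.negOnePow_def, Units.smul_def]
  simp

/-- The weight on the left is even in `j`; the one on the right is written in terms of the index
`m + j` of the coefficient. -/
lemma choose_div_choose (m : ℕ) (j : ℤ) (hj : j.natAbs ≤ m) :
    ((m + j.natAbs).choose j.natAbs : ℂ) / (m.choose j.natAbs : ℂ) =
      ((2 * m).choose m : ℂ) / ((2 * m).choose (m + j).toNat : ℂ) := by
  obtain ⟨d, rfl⟩ := Nat.exists_eq_add_of_le hj
  set N := j.natAbs with hN
  have hs : (2 * (N + d)).choose ((N + d : ℕ) + j).toNat = (2 * (N + d)).choose d := by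
    rcases le_total 0 j with h | h
    · exact Nat.choose_symm_of_eq_add (by omega)
    · congr 1; omega
  rw [hs]
  have h1 : ((N + d + N).choose N : ℂ) * (N + d).factorial * N.factorial =
      (N + d + N).factorial := by
    rw [add_comm (N + d), mul_right_comm]
    exact cast_add_choose_mul_factorial N (N + d)
  have h2 : ((N + d).choose N : ℂ) * N.factorial * d.factorial = (N + d).factorial := by
    exact cast_add_choose_mul_factorial N d
  have h3 : ((2 * (N + d)).choose (N + d) : ℂ) * (N + d).factorial * (N + d).factorial =
      (2 * (N + d)).factorial := by
    rw [two_mul]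
    exact cast_add_choose_mul_factorial (N + d) (N + d)
  have h4 : ((2 * (N + d)).choose d : ℂ) * d.factorial * (N + d + N).factorial =
      (2 * (N + d)).factorial := by
    rw [show 2 * (N + d) = d + (N + d + N) by omega]
    exact cast_add_choose_mul_factorial d (N + d + N)
  have n0 : ∀ n : ℕ, (n.factorial : ℂ) ≠ 0 := fun n => by exact_mod_cast n.factorial_ne_zero
  have n1 : ((N + d).choose N : ℂ) ≠ 0 := by
    exact_mod_cast (Nat.choose_pos (Nat.le_add_right N d)).ne'
  have n2 : ((2 * (N + d)).choose d : ℂ) ≠ 0 := by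
    exact_mod_cast (Nat.choose_pos (by omega)).ne'
  rw [div_eq_div_iff n1 n2]
  apply mul_right_cancel₀ (mul_ne_zero (mul_ne_zero (n0 N) (n0 d)) (n0 (N + d)))
  rw [← h1, ← h3] at h4
  have h5 : ((2 * (N + d)).choose d : ℂ) * d.factorial * ((N + d + N).choose N : ℂ) *
      N.factorial = ((2 * (N + d)).choose (N + d) : ℂ) * (N + d).factorial := by
    apply mul_right_cancel₀ (n0 (N + d))
    linear_combination h4
  linear_combination ((N + d).factorial : ℂ) * h5 -
    ((2 * (N + d)).choose (N + d) : ℂ) * (N + d).factorial * h2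

/-- The modes of index `j` and `-j` carry the same square roots, so the product does not depend on
their branch. -/
lemma Y_mul_Y_neg (m : ℕ) (j : ℤ) (hj : j.natAbs ≤ m) (p q : Omega) :
    Y j m p * Y (-j) m q = (2 * m + 1) * ((-1) ^ j.natAbs *
      (((2 * m).choose m : ℂ) / ((2 * m).choose (m + j).toNat : ℂ))) *
        (PFM j m p * PFM (-j) m q) := by
  have h1 : ((√(2 * m + 1 : ℝ) : ℝ) : ℂ) * ((√(2 * m + 1 : ℝ) : ℝ) : ℂ) = 2 * m + 1 := by
    rw [← Complex.ofReal_mul, Real.mul_self_sqrt (by positivity)]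
    push_cast; rfl
  have hc : (m.choose j.natAbs : ℂ) ≠ 0 := by exact_mod_cast (Nat.choose_pos hj).ne'
  have hr : ((Ring.choose (-(m : ℤ) - 1) j.natAbs : ℤ) : ℂ) =
      (-1) ^ j.natAbs * ((m + j.natAbs).choose j.natAbs : ℂ) := by
    rw [ring_choose_neg_sub_one]; push_cast; rfl
  have hr0 : ((Ring.choose (-(m : ℤ) - 1) j.natAbs : ℤ) : ℂ) ≠ 0 := by
    rw [hr]
    refine mul_ne_zero (pow_ne_zero _ (by norm_num)) ?_
    exact_mod_cast (Nat.choose_pos (Nat.le_add_left _ _)).ne'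
  have h2 : (m.choose j.natAbs : ℂ) ^ (-(1 / 2) : ℂ) * (m.choose j.natAbs : ℂ) ^ (-(1 / 2) : ℂ) =
      (m.choose j.natAbs : ℂ)⁻¹ := by
    rw [← Complex.cpow_add _ _ hc, ← Complex.cpow_neg_one]; norm_num
  have h3 : ((Ring.choose (-(m : ℤ) - 1) j.natAbs : ℤ) : ℂ) ^ (1 / 2 : ℂ) *
      ((Ring.choose (-(m : ℤ) - 1) j.natAbs : ℤ) : ℂ) ^ (1 / 2 : ℂ) =
      (-1) ^ j.natAbs * ((m + j.natAbs).choose j.natAbs : ℂ) := by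
    rw [← Complex.cpow_add _ _ hr0, ← hr]; norm_num
  rw [← choose_div_choose m j hj, ← h1, mul_div_assoc', ← h3, div_eq_mul_inv, ← h2, Y, Y,
    Int.natAbs_neg]
  ring

lemma Z_eq_sum_range (m : ℕ) (p q : Omega) : Z m p q =
    ∑ i ∈ Finset.range (2 * m + 1), Y ((i : ℤ) - m) m p * Y (-((i : ℤ) - m)) m q := by
  refine Finset.sum_nbij' (fun j => (m + j).toNat) (fun i => (i : ℤ) - m) ?_ ?_ ?_ ?_ ?_
  · intro j hj; simp only [Finset.mem_Icc, Finset.mem_range] at hj ⊢; omega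
  · intro j hj; simp only [Finset.mem_Icc, Finset.mem_range] at hj ⊢; omega
  · intro j hj; simp only [Finset.mem_Icc] at hj; omega
  · intro j _; omega
  · intro j hj
    simp only [Finset.mem_Icc] at hj
    rw [show (((m + j).toNat : ℕ) : ℤ) - m = j by omega]

/-! ### Zonal harmonics -/

/-- The zonal harmonic at `p = ((a : b), (c : d))` and `q = ((e : f), (g : h))`, in terms of a
point `r` whose coordinates are determinants of those of `p` and `q`. -/
theorem Z_eq_PFM (m : ℕ) (p q r : Omega) {a b c d e f g h : ℂ}
    (hz : IsCoord p.1.1 a b) (hw : IsCoord p.1.2 c d)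
    (hu : IsCoord q.1.1 e f) (hv : IsCoord q.1.2 g h)
    (hr₁ : IsCoord r.1.1 (a * f - b * e) (a * g - b * h))
    (hr₂ : IsCoord r.1.2 (d * g - c * h) (d * f - c * e)) :
    Z m p q = (2 * m + 1) * PFM 0 m r := by
  have hR : PFM 0 m r = (-1) ^ m * (b * d - a * c) ^ (-(m : ℤ)) * (f * h - e * g) ^ (-(m : ℤ)) *
      formCoeff m (a * f - b * e) (a * g - b * h) (d * g - c * h) (d * f - c * e) m := by
    -- the determinant of `r` is minus the product of those of `p` and `q`
    rw [PFM_eq 0 m (by simp) r hr₁ hr₂,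
      show (a * g - b * h) * (d * f - c * e) - (a * f - b * e) * (d * g - c * h) =
        -1 * ((b * d - a * c) * (f * h - e * g)) by ring, mul_zpow, mul_zpow]
    have : ((-1 : ℂ)) ^ (-(m : ℤ)) = (-1) ^ m := by
      rw [zpow_neg, zpow_natCast, ← inv_pow, inv_neg_one]
    rw [this, zpow_zero, add_zero, Int.toNat_natCast]
    ring
  rw [hR, ← sum_formCoeff_mul_formCoeff, Z_eq_sum_range, Finset.mul_sum, Finset.mul_sum]
  refine Finset.sum_congr rfl fun i hi => ?_
  have hi : i ≤ 2 * m := Nat.lt_succ_iff.1 (Finset.mem_range.1 hi)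
  rw [Y_mul_Y_neg m _ (by omega), PFM_eq _ m (by omega) p hz hw, PFM_eq _ m (by omega) q hu hv,
    show ((m : ℤ) + (i - m)).toNat = i by omega,
    show ((m : ℤ) + -((i : ℤ) - m)).toNat = 2 * m - i by omega]
  have h1 : (-1 : ℂ) ^ ((i : ℤ) - m) * (-1) ^ (-((i : ℤ) - m)) = 1 := by
    rw [← zpow_add₀ (by norm_num), add_neg_cancel, zpow_zero]
  have h2 : (-1 : ℂ) ^ ((i : ℤ) - m).natAbs = (-1) ^ i * (-1) ^ m := by
    rw [← pow_add]
    exact neg_one_pow_congr (by grind)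
  rw [h2]
  linear_combination (2 * m + 1) * ((-1) ^ i * (-1) ^ m * (((2 * m).choose m : ℂ) /
    ((2 * m).choose i : ℂ))) * ((b * d - a * c) ^ (-(m : ℤ)) * formCoeff m a b c d i *
    ((f * h - e * g) ^ (-(m : ℤ)) * formCoeff m e f g h (2 * m - i))) * h1

/-! ### Coordinates of the automorphisms -/

lemma isCoord_psi {u v : ℂ} (huv : u * v ≠ 1) {z : Sphere} {a b : ℂ} (h : IsCoord z a b) :
    IsCoord (psi u v z) (b * u - a) (b - a * v) := by
  induction z using OnePoint.rec with
  | infty =>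
    obtain ⟨s, hs, rfl, rfl⟩ := h.exists_infty
    by_cases hv : v = 0
    · exact Or.inr ⟨by simp [hv], by simpa using hs, by simp [psi, hv]⟩
    · refine Or.inl ⟨by simp [hs, hv], ?_⟩
      simp only [psi, hv, if_false, OnePoint.coe_eq_coe]
      field_simp
      simp
  | coe z =>
    obtain ⟨s, hs, rfl, rfl⟩ := h.exists_coe
    have : IsCoord (psi u v z) (u - z) (1 - v * z) := by
      by_cases hv : 1 - v * z = 0
      · refine Or.inr ⟨hv, fun h => huv ?_, by simp [psi, hv]⟩
        linear_combination v * h - hv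
      · exact Or.inl ⟨hv, by simp [psi, hv]⟩
    convert this.smul hs using 1 <;> ring

lemma isCoord_sphereInv {z : Sphere} {a b : ℂ} (h : IsCoord z a b) :
    IsCoord (sphereInv z) b a := by
  rcases h with ⟨hb, rfl⟩ | ⟨rfl, ha, rfl⟩
  · by_cases ha : a = 0
    · exact Or.inr ⟨ha, hb, by simp [sphereInv, ha]⟩
    · exact Or.inl ⟨ha, by simp [sphereInv, ha, hb]⟩
  · exact Or.inl ⟨ha, by simp [sphereInv]⟩

lemma sphereInv_sphereInv (z : Sphere) : sphereInv (sphereInv z) = z := by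
  induction z using OnePoint.rec with
  | infty => simp [sphereInv]
  | coe z => by_cases hz : z = 0 <;> simp [sphereInv, hz]

lemma isCoord_toComplex {z : Sphere} (hz : z ≠ ∞) : IsCoord z (toComplex z) 1 := by
  induction z using OnePoint.rec with
  | infty => exact absurd rfl hz
  | coe z => exact isCoord_coe z

lemma isCoord_of_sphereInv_ne_infty {z : Sphere} (hz : sphereInv z ≠ ∞) :
    IsCoord z 1 (toComplex (sphereInv z)) := by
  simpa [sphereInv_sphereInv] using isCoord_sphereInv (isCoord_toComplex hz)

theorem Z_eq_PFM_T (m : ℕ) (p q : Omega) (hq : IsFinite q) :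
    Z m p q = (2 * m + 1) * PFM 0 m (T q hq p) := by
  obtain ⟨a, b, hz⟩ := exists_isCoord p.1.1
  obtain ⟨c, d, hw⟩ := exists_isCoord p.1.2
  have huv := toComplex_mul_ne_one hq
  refine Z_eq_PFM m p q _ hz hw (isCoord_toComplex hq.1) (isCoord_toComplex hq.2) ?_ ?_
  · convert (isCoord_psi huv hz).smul (neg_ne_zero.2 one_ne_zero) using 1 <;> first | ring1 | rfl
  · convert isCoord_psi (mul_comm (toComplex q.1.1) _ ▸ huv) hw using 1 <;> first | ring1 | rfl

lemma PFM_zero_swap (m : ℕ) (r s : Omega) (h₁ : r.1.1 = s.1.2) (h₂ : r.1.2 = s.1.1) :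
    PFM 0 m r = PFM 0 m s := by
  obtain ⟨a, b, hz⟩ := exists_isCoord r.1.1
  obtain ⟨c, d, hw⟩ := exists_isCoord r.1.2
  rw [PFM_eq 0 m (by simp) r hz hw, PFM_eq 0 m (by simp) s (h₂ ▸ hw) (h₁ ▸ hz), add_zero,
    Int.toNat_natCast, formCoeff_swap_middle, mul_comm b, mul_comm a]

lemma swap_mem_Omega {p : Sphere × Sphere} (hp : p ∈ Omega) : p.swap ∈ Omega := by
  obtain ⟨z, w⟩ := p
  induction z using OnePoint.rec with
  | infty =>
    induction w using OnePoint.rec with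
    | infty => exact hp
    | coe w => exact (mem_Omega_coe_infty w).2 ((mem_Omega_infty_coe w).1 hp)
  | coe z =>
    induction w using OnePoint.rec with
    | infty => exact (mem_Omega_infty_coe z).2 ((mem_Omega_coe_infty z).1 hp)
    | coe w => exact (mem_Omega_coe w z).2 (mul_comm z w ▸ (mem_Omega_coe z w).1 hp)

theorem Z_eq_PFM_Ttilde (m : ℕ) (p q : Omega) (hq : IsNonzero q) :
    Z m p q = (2 * m + 1) * PFM 0 m (Ttilde q hq p) := by
  obtain ⟨a, b, hz⟩ := exists_isCoord p.1.1
  obtain ⟨c, d, hw⟩ := exists_isCoord p.1.2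
  have hf := isFinite_flipMap hq
  have huv : toComplex (sphereInv q.1.2) * toComplex (sphereInv q.1.1) ≠ 1 :=
    toComplex_mul_ne_one hf
  -- with `u = 1 / u'`, `v = 1 / v'` the point with determinant coordinates is `Ttilde q hq p`
  -- with its components exchanged
  rw [PFM_zero_swap m (Ttilde q hq p) ⟨_, swap_mem_Omega (Ttilde q hq p).2⟩ rfl rfl]
  refine Z_eq_PFM m p q _ hz hw (isCoord_of_sphereInv_ne_infty hf.2)
    (isCoord_of_sphereInv_ne_infty hf.1) ?_ ?_
  · convert isCoord_psi (mul_comm (toComplex (sphereInv q.1.2)) _ ▸ huv) (isCoord_sphereInv hz)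
      using 1 <;> first | ring1 | rfl
  · convert (isCoord_psi huv (isCoord_sphereInv hw)).smul (neg_ne_zero.2 one_ne_zero) using 1 <;>
      first | ring1 | rfl

end ComplexZonal

theorem mainTheorem9 (m : ℕ) (p q : ComplexZonal.Omega) :
    (∀ hq : ComplexZonal.IsFinite q,
      ComplexZonal.Z m p q = (2 * m + 1) * (ComplexZonal.PFM 0 m ∘ ComplexZonal.T q hq) p) ∧
    (∀ hq : ComplexZonal.IsNonzero q,
      ComplexZonal.Z m p q = (2 * m + 1) * (ComplexZonal.PFM 0 m ∘ ComplexZonal.Ttilde q hq) p) :=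
  ⟨ComplexZonal.Z_eq_PFM_T m p q, ComplexZonal.Z_eq_PFM_Ttilde m p q⟩
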